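/- Let $n\ge 0$, $k\ge 1$ be integers, $T>0$, and let $\{\mu_t\}_{t\ge 0}$ be an integral $n$-dimensional Brakke flow in $\mathbb{R}^{n+k}$ with bounded area ratios. If $$\mathcal{H}^n\big((\operatorname{sing}^+\mu)_t\big)=0\qquad\text{for every } t\in(0,T),$$ then for every $\phi\in C^2_c(\mathbb{R}^{n+k},\mathbb{R}_{\ge 0})$ the function $t\mapsto \mu_t(\phi):=\int\phi\,d\mu_t$ is continuous on $(0,T)$. Here the terms are used as follows. (1) An integral $n$-dimensional Brakke flow is a family of Radon measures $\mu_t$, $t\ge0$, on $\mathbb{R}^{n+k}$ such that $\mu_t$ is integer $n$-rectifiable for a.e. $t\ge 0$ and, for all $\phi\in C^2_c(\mathbb{R}^{n+k},\mathbb{R}_{\ge0})$ and $t\ge 0$, $$\limsup_{s\to t,\ s\ge 0}\frac{\mu_s(\phi)-\mu_t(\phi)}{s-t}\ \le\ \mathcal{B}(\mu_t,\phi).$$ Here $\mathcal{B}(\mu,\phi)=\int -\phi|\vec H_\mu|^2+\nabla\phi\cdot (T_x\mu)^\perp\cdot\vec H_\mu\,d\mu$, where $(T_x\mu)^\perp\cdot$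 is the orthogonal projection onto $(T_x\mu)^\perp$, if on the open set $\{\phi>0\}$ the measure $\mu$ is $n$-rectifiable, the total variation $|\delta V_\mu|$ of the first variation $\delta V_\mu(X)=\int \operatorname{div}_{T_x\mu}X\,d\mu$ is a Radon measure with no singular part with respect to $\mu$, and $\int\phi|\vec H_\mu|^2\,d\mu<\infty$; otherwise $\mathcal{B}(\mu,\phi)=-\infty$. The generalized mean curvature $\vec H_\mu$ is determined by $\delta V_\mu(X)=-\int\langle\vec H_\mu,X\rangle\,d\mu$ for $X\in C^1_c(\{\phi>0\},\mathbb{R}^{n+k})$. (2) Bounded area ratios: $\sup_{t\ge0}\sup_{R>0}\sup_{x}\mu_t(B_R(x))/(\omega_nR^n)<\infty$, where $\omega_n$ is the volume of the unit ball of $\mathbb{R}^n$. (3) The spacetime support $\operatorname{spt}\mu$ is the closure of $\bigcup_{t\ge0}\operatorname{spt}\mu_t\times\{t\}$ in $\mathbb{R}^{n+k}\times[0,\infty)$. A point $(x_0,t_0)$ is fully smooth if for some $r,\varepsilon>0$ with $\varepsilon^2\le t_0$ there is a smooth proper mean curvature flow $(M_s)$ of nonempty connected embedded $n$-dimensional submanifolds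 of $B_r(x_0)$, $s\in(t_0-\varepsilon^2,t_0+\varepsilon^2)$, with bounded curvature, such that $\mu_s\lfloor B_r(x_0)=\mathcal{H}^n\lfloor M_s$ for all such $s$. Proper means that the spacetime track of $(M_s)$ is relatively closed in $B_r(x_0)\times(t_0-\varepsilon^2,t_0+\varepsilon^2)$. Finally, $\operatorname{sing}^+\mu$ is the set of points of $\operatorname{spt}\mu$ that are neither fully smooth nor in $\operatorname{spt}\mu_0\times\{0\}$, and $(\operatorname{sing}^+\mu)_t$ is its slice at time $t$. -/

import Mathlib

open MeasureTheory Filter Topology Set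
open scoped ENNReal NNReal ContDiff

noncomputable section

namespace BrakkeFlow

/-- `E N` is Euclidean space `ℝᴺ`. Throughout, `μHE[n]` is the `n`-dimensional Hausdorff measure
with the usual normalisation (it agrees with Lebesgue measure on `n`-dimensional subspaces). -/
abbrev E (N : ℕ) : Type := EuclideanSpace ℝ (Fin N)

/-- The class `C²_c(ℝᴺ, ℝ_{≥ 0})` of test functions. -/
structure IsTestFunction {N : ℕ} (φ : E N → ℝ) : Prop where
  contDiff : ContDiff ℝ 2 φ
  hasCompactSupport : HasCompactSupport φ
  nonneg : ∀ x, 0 ≤ φ x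

/-! ### Rectifiable measures, first variation, generalised mean curvature -/

/-- Countably `n`-rectifiable sets: covered, up to an `ℋⁿ`-null set, by countably many Lipschitz
images of `ℝⁿ`. -/
def IsCountablyRectifiable (n : ℕ) {N : ℕ} (S : Set (E N)) : Prop :=
  ∃ f : ℕ → E n → E N, (∀ j, ∃ K : ℝ≥0, LipschitzWith K (f j)) ∧
    μHE[n] (S \ ⋃ j, range (f j)) = 0

/-- `μ = θ ℋⁿ` with a locally `ℋⁿ`-integrable density `θ ≥ 0` and `{θ > 0}` countably
`n`-rectifiable. -/
structure HasRectifiableDensity (n : ℕ) {N : ℕ} (μ : Measure (E N)) (θ : E N → ℝ≥0) : Prop where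
  measurable : Measurable θ
  locallyIntegrable : ∀ K : Set (E N), IsCompact K → ∫⁻ x in K, θ x ∂μHE[n] < ⊤
  rectifiable : IsCountablyRectifiable n {x | 0 < θ x}
  eq_withDensity : μ = (μHE[n]).withDensity (fun x => (θ x : ℝ≥0∞))

/-- `μ` is an `n`-rectifiable Radon measure. -/
def IsRectifiable (n : ℕ) {N : ℕ} (μ : Measure (E N)) : Prop :=
  ∃ θ : E N → ℝ≥0, HasRectifiableDensity n μ θ

/-- `μ` is an integer `n`-rectifiable Radon measure. -/
def IsIntegerRectifiable (n : ℕ) {N : ℕ} (μ : Measure (E N)) : Prop :=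
  ∃ θ : E N → ℝ≥0, HasRectifiableDensity n μ θ ∧ ∀ x, ∃ m : ℕ, θ x = m

/-- `P` is an approximate tangent plane of `μ` at `x`: the blow-ups of `μ` at `x` converge, as
Radon measures, to a positive multiple of `ℋⁿ ⌊ P`. -/
def IsApproxTangentPlane (n : ℕ) {N : ℕ} (μ : Measure (E N)) (x : E N)
    (P : Submodule ℝ (E N)) : Prop :=
  Module.finrank ℝ P = n ∧ ∃ c : ℝ, 0 < c ∧
    ∀ f : E N → ℝ, Continuous f → HasCompactSupport f →
      Tendsto (fun r : ℝ => (r ^ n)⁻¹ * ∫ y, f (r⁻¹ • (y - x)) ∂μ) (𝓝[>] 0)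
        (𝓝 (c * ∫ y in (P : Set (E N)), f y ∂μHE[n]))

open Classical in
/-- The approximate tangent plane `T_x μ`; an `n`-rectifiable Radon measure `μ` has exactly one at
`μ`-almost every point. (The value is `⊥` at points where there is none.) -/
def approxTangentPlane (n : ℕ) {N : ℕ} (μ : Measure (E N)) (x : E N) : Submodule ℝ (E N) :=
  if h : ∃ P, IsApproxTangentPlane n μ x P then h.choose else ⊥

/-- The divergence `div_P X (x)` of the vector field `X` along the plane `P`. -/
def divAlong {N : ℕ} (P : Submodule ℝ (E N)) (X : E N → E N) (x : E N) : ℝ :=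
  LinearMap.trace ℝ (E N) (P.starProjection ∘L fderiv ℝ X x : E N →L[ℝ] E N).toLinearMap

/-- The first variation `δV_μ (X) = ∫ div_{T_x μ} X dμ`. -/
def firstVariation (n : ℕ) {N : ℕ} (μ : Measure (E N)) (X : E N → E N) : ℝ :=
  ∫ x, divAlong (approxTangentPlane n μ x) X x ∂μ

/-- The first variation of `V_μ` in the open set `U` is represented by the Radon measure `σ` on `U`
and the `σ`-a.e. unit vector field `ν`. Such a `σ` exists if and only if the total variation
`|δV_μ| ⌊ U` is a Radon measure on `U`, and then `σ = |δV_μ| ⌊ U`. -/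
structure IsFirstVariationPolar (n : ℕ) {N : ℕ} (μ : Measure (E N)) (U : Set (E N))
    (σ : Measure (E N)) (ν : E N → E N) : Prop where
  compl_null : σ Uᶜ = 0
  lt_top_of_isCompact : ∀ K : Set (E N), IsCompact K → K ⊆ U → σ K < ⊤
  measurable : Measurable ν
  norm_eq_one : ∀ᵐ x ∂σ, ‖ν x‖ = 1
  firstVariation_eq : ∀ X : E N → E N, ContDiff ℝ 1 X → HasCompactSupport X → tsupport X ⊆ U →
    firstVariation n μ X = ∫ x, inner ℝ (ν x) (X x) ∂σ

/-- `|δV_μ| ⌊ U` is a Radon measure on `U` without singular part with respect to `μ`, and `H` is the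
generalised mean curvature vector of `μ` in `U`. It is `-(d|δV_μ|/dμ) ν`, so that
`δV_μ (X) = -∫ ⟨H, X⟩ dμ`. -/
def IsGeneralizedMeanCurvature (n : ℕ) {N : ℕ} (μ : Measure (E N)) (U : Set (E N))
    (H : E N → E N) : Prop :=
  ∃ (σ : Measure (E N)) (ν : E N → E N), IsFirstVariationPolar n μ U σ ν ∧
    σ.singularPart μ = 0 ∧ H = fun x => -((σ.rnDeriv μ x).toReal • ν x)

/-! ### Brakke flows -/

/-- The four conditions under which the Brakke functional is finite; `H` is the generalised mean
curvature vector of `μ` in `{φ > 0}`. -/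
structure IsBrakkeAdmissible (n : ℕ) {N : ℕ} (μ : Measure (E N)) (φ : E N → ℝ)
    (H : E N → E N) : Prop where
  rectifiable : IsRectifiable n (μ.restrict {x | 0 < φ x})
  meanCurvature : IsGeneralizedMeanCurvature n μ {x | 0 < φ x} H
  lintegral_lt_top : ∫⁻ x, ENNReal.ofReal (φ x * ‖H x‖ ^ 2) ∂μ < ⊤

open Classical in
/-- The Brakke functional
`ℬ(μ, φ) = ∫ -φ |H|² + ∇φ · (T_x μ)^⊥ · H dμ`, and `-∞` if one of the conditions fails. -/
def brakkeFunctional (n : ℕ) {N : ℕ} (μ : Measure (E N)) (φ : E N → ℝ) : EReal :=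
  if h : ∃ H, IsBrakkeAdmissible n μ φ H then
    ((∫ x, (-(φ x * ‖h.choose x‖ ^ 2) +
      inner ℝ (gradient φ x)
        ((approxTangentPlane n μ x)ᗮ.starProjection (h.choose x))) ∂μ : ℝ) : EReal)
  else ⊥

/-- The upper derivative at `t` of a function on `[0, ∞)`, with values in `[-∞, ∞]`. -/
def upperDeriv (f : ℝ → ℝ) (t : ℝ) : EReal :=
  limsup (fun s => (((f s - f t) / (s - t) : ℝ) : EReal)) (𝓝[Ici 0 \ {t}] t)

/-- A family of Radon measures `(μ_t)_{t ≥ 0}` is an integral `n`-dimensional Brakke flow in `ℝᴺ`.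
Only the values `μ t` with `t ≥ 0` matter. -/
structure IsIntegralBrakkeFlow (n : ℕ) {N : ℕ} (μ : ℝ → Measure (E N)) : Prop where
  radon : ∀ t, 0 ≤ t → IsLocallyFiniteMeasure (μ t)
  integral : ∀ᵐ t ∂(volume.restrict (Ici (0 : ℝ))), IsIntegerRectifiable n (μ t)
  brakke : ∀ φ : E N → ℝ, IsTestFunction φ → ∀ t, 0 ≤ t →
    upperDeriv (fun s => ∫ x, φ x ∂(μ s)) t ≤ brakkeFunctional n (μ t) φ

/-- Bounded area ratios: `μ_t(B_R(x)) ≤ Λ ω_n Rⁿ` for all `t ≥ 0`, `R > 0` and `x`, where `ω_n` is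
the volume of the unit ball of `ℝⁿ`. -/
def HasBoundedAreaRatios (n : ℕ) {N : ℕ} (μ : ℝ → Measure (E N)) : Prop :=
  ∃ Λ : ℝ≥0, ∀ t, 0 ≤ t → ∀ R : ℝ, 0 < R → ∀ x : E N,
    μ t (Metric.ball x R) ≤ Λ * (volume (Metric.ball (0 : E n) 1) * ENNReal.ofReal (R ^ n))

/-! ### Smooth mean curvature flows of submanifolds -/

/-- The `i`-th standard basis vector of `ℝⁿ`. -/
abbrev stdVec (n : ℕ) (i : Fin n) : E n := EuclideanSpace.single i (1 : ℝ)

/-- The second fundamental form `A(df v, df w) = (D²f (v, w))^⊥` of an immersion `f` at `p`. -/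
def secondFundForm {n N : ℕ} (f : E n → E N) (p v w : E n) : E N :=
  (LinearMap.range (fderiv ℝ f p).toLinearMap)ᗮ.starProjection (fderiv ℝ (fderiv ℝ f) p v w)

/-- The induced metric `g_{ij} = ⟨∂_i f, ∂_j f⟩`. -/
def inducedMetric {n N : ℕ} (f : E n → E N) (p : E n) : Matrix (Fin n) (Fin n) ℝ :=
  Matrix.of fun i j => inner ℝ (fderiv ℝ f p (stdVec n i)) (fderiv ℝ f p (stdVec n j))

/-- The mean curvature vector `∑ g^{ij} A(∂_i f, ∂_j f)` of an immersion `f` at `p`. -/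
def meanCurvature {n N : ℕ} (f : E n → E N) (p : E n) : E N :=
  ∑ i, ∑ j, (inducedMetric f p)⁻¹ i j • secondFundForm f p (stdVec n i) (stdVec n j)

/-- The spacetime track over the time set `I` of a family of sets. -/
def track {N : ℕ} (M : ℝ → Set (E N)) (I : Set ℝ) : Set (E N × ℝ) :=
  {X | X.2 ∈ I ∧ X.1 ∈ M X.2}

/-- A smooth local parametrisation of a moving family of embedded `n`-dimensional submanifolds:
`(p, s) ↦ (F (p, s), s)` is a smooth embedding of the open set `Ω ⊆ ℝⁿ × ℝ` onto a relatively open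
subset of the spacetime track, and `F (·, s)` is an immersion for each `s`. -/
structure IsFlowChart {n N : ℕ} (M : ℝ → Set (E N)) (I : Set ℝ) (Ω : Set (E n × ℝ))
    (F : E n × ℝ → E N) : Prop where
  isOpen : IsOpen Ω
  contDiffOn : ContDiffOn ℝ ∞ F Ω
  immersion : ∀ q ∈ Ω, Function.Injective (fderiv ℝ (fun p => F (p, q.2)) q.1)
  isEmbedding : IsEmbedding (fun q : Ω => (F q, (q : E n × ℝ).2))
  image_eq : ∃ Z : Set (E N × ℝ), IsOpen Z ∧ track M I ∩ Z = (fun q => (F q, q.2)) '' Ω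

/-- `(M_s)_{s ∈ I}` is a smooth proper mean curvature flow of embedded connected non-empty
`n`-dimensional submanifolds of the open set `U`, with bounded curvature. -/
structure IsSmoothProperMCF (n : ℕ) {N : ℕ} (U : Set (E N)) (I : Set ℝ)
    (M : ℝ → Set (E N)) : Prop where
  subset : ∀ s ∈ I, M s ⊆ U
  /-- `IsConnected` includes being non-empty. -/
  connected : ∀ s ∈ I, IsConnected (M s)
  /-- Properness: the track is relatively closed in `U × I`. -/
  proper : closure (track M I) ∩ U ×ˢ I ⊆ track M I
  exists_chart : ∀ X ∈ track M I, ∃ (Ω : Set (E n × ℝ)) (F : E n × ℝ → E N),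
    IsFlowChart M I Ω F ∧ ∃ q ∈ Ω, (F q, q.2) = X
  /-- The normal velocity is the mean curvature vector. -/
  flow_eq : ∀ (Ω : Set (E n × ℝ)) (F : E n × ℝ → E N), IsFlowChart M I Ω F → ∀ q ∈ Ω,
    (LinearMap.range (fderiv ℝ (fun p => F (p, q.2)) q.1).toLinearMap)ᗮ.starProjection
        (deriv (fun s => F (q.1, s)) q.2) =
      meanCurvature (fun p => F (p, q.2)) q.1
  /-- The second fundamental form is bounded, uniformly in space and time. -/
  bounded_curvature : ∃ C : ℝ, ∀ (Ω : Set (E n × ℝ)) (F : E n × ℝ → E N),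
    IsFlowChart M I Ω F → ∀ q ∈ Ω, ∀ v w : E n,
      ‖secondFundForm (fun p => F (p, q.2)) q.1 v w‖ ≤
        C * ‖fderiv ℝ (fun p => F (p, q.2)) q.1 v‖ * ‖fderiv ℝ (fun p => F (p, q.2)) q.1 w‖

/-! ### Spacetime support and singular set -/

/-- The spacetime support: the closure of `⋃_{t ≥ 0} spt μ_t × {t}` in spacetime. -/
def spacetimeSupport {N : ℕ} (μ : ℝ → Measure (E N)) : Set (E N × ℝ) :=
  closure {X | 0 ≤ X.2 ∧ X.1 ∈ (μ X.2).support}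

/-- `(x₀, t₀)` is a fully smooth point of the flow: in `B_r(x₀)` and for times in
`(t₀ - ε², t₀ + ε²)`, which must be times at which the flow is defined, `μ_s` is the area measure of
a smooth proper mean curvature flow. -/
def IsFullySmooth (n : ℕ) {N : ℕ} (μ : ℝ → Measure (E N)) (X₀ : E N × ℝ) : Prop :=
  ∃ r ε : ℝ, 0 < r ∧ 0 < ε ∧ 0 ≤ X₀.2 - ε ^ 2 ∧ ∃ M : ℝ → Set (E N),
    IsSmoothProperMCF n (Metric.ball X₀.1 r) (Ioo (X₀.2 - ε ^ 2) (X₀.2 + ε ^ 2)) M ∧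
    ∀ s ∈ Ioo (X₀.2 - ε ^ 2) (X₀.2 + ε ^ 2),
      (μ s).restrict (Metric.ball X₀.1 r) = (μHE[n]).restrict (M s)

/-- The regular set `reg⁺ μ`. -/
def regPlus (n : ℕ) {N : ℕ} (μ : ℝ → Measure (E N)) : Set (E N × ℝ) :=
  (μ 0).support ×ˢ {0} ∪ {X | X ∈ spacetimeSupport μ ∧ IsFullySmooth n μ X}

/-- The singular set `sing⁺ μ = spt μ \ reg⁺ μ`. -/
def singPlus (n : ℕ) {N : ℕ} (μ : ℝ → Measure (E N)) : Set (E N × ℝ) :=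
  spacetimeSupport μ \ regPlus n μ

/-- The time slice `(sing⁺ μ)_t`, as a subset of `ℝᴺ`. -/
def singPlusSlice (n : ℕ) {N : ℕ} (μ : ℝ → Measure (E N)) (t : ℝ) : Set (E N) :=
  {x | (x, t) ∈ singPlus n μ}

end BrakkeFlow

end

namespace BrakkeFlow

/-! Fix a time t₀ in (0, T) and let S be the singular slice at t₀. Two facts combine.

Near S no mass can appear or vanish. Since ℋⁿ(S) = 0, the set S is covered by balls with ∑ Rᵢⁿ as
small as desired, and bounded area ratios turn this one cover into an open V ⊇ S with μ_s(V) ≤ ε for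
all s ≥ 0 at once (`exists_isOpen_forall_measure_le`).

Off S the flow is locally weakly continuous at t₀. A point outside the spacetime support has a
neighbourhood without mass at nearby times. At a fully smooth point the flow is locally the area
measure of a smoothly moving patch F(·, s), where F(·, s) and F(·, t₀) induce distances comparable
with constants tending to 1; area, being Hausdorff measure, is then comparable with constants
tending to 1 (`exists_ball_eventually_edist_le`, `tendsto_setIntegral_image_ball`).

A cut-off splits a test function into a piece supported off S, treated by a partition of unity, and
a piece living in V, whose integral is uniformly small
(`continuousAt_integral_of_locally_off_small`). -/

/-! ### Covering null sets under bounded area ratios -/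

/-- An `ℋⁿ`-null set has an open neighbourhood that is uniformly small for all measures with a
given bound on their area ratios. -/
theorem exists_isOpen_forall_measure_le {X : Type*} [MetricSpace X] [MeasurableSpace X]
    [BorelSpace X] {n : ℕ} {S : Set X} (hS : μHE[n] S = 0) {C ε : ℝ≥0∞} (hC : C ≠ ⊤)
    (hε : ε ≠ 0) :
    ∃ V : Set X, IsOpen V ∧ S ⊆ V ∧ ∀ ν : Measure X,
      (∀ R : ℝ, 0 < R → ∀ x, ν (Metric.ball x R) ≤ C * ENNReal.ofReal (R ^ n)) → ν V ≤ ε := by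
  have hS' : μH[(n : ℝ)] S = 0 := by
    rw [Measure.euclideanHausdorffMeasure_def, Measure.smul_apply, ENNReal.smul_def, smul_eq_mul,
      mul_eq_zero] at hS
    refine hS.resolve_left ?_
    exact_mod_cast Measure.addHaarScalarFactor_volume_hausdorffMeasure_ne_zero n
  -- The factor 2 pays for two errors of size δ: the sum of the cover, and the enlargement of its
  -- members to balls.
  obtain ⟨δ, hδ, hδε⟩ := ENNReal.exists_nnreal_pos_mul_lt (ENNReal.mul_ne_top hC (by simp :
    (2 : ℝ≥0∞) ≠ ⊤)) hε
  have hδ' : (δ : ℝ≥0∞) ≠ 0 := by exact_mod_cast hδ.ne'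
  rw [Measure.hausdorffMeasure_apply] at hS'
  -- Covers at scale 1 suffice: the bound on the diameters is only needed for their finiteness.
  have h1 := (le_iSup₂ (f := fun (r : ℝ≥0∞) (_ : 0 < r) =>
    ⨅ (t : ℕ → Set X) (_ : S ⊆ ⋃ n, t n) (_ : ∀ n, Metric.ediam (t n) ≤ r),
          ∑' m, ⨆ _ : (t m).Nonempty, Metric.ediam (t m) ^ (n : ℝ)) 1 one_pos).trans hS'.le
  have h2 := lt_of_le_of_lt h1 (pos_iff_ne_zero.2 hδ')
  simp only [iInf_lt_iff] at h2
  obtain ⟨t, hSt, htd, ht⟩ := h2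
  obtain ⟨η, hη, hηδ⟩ := ENNReal.exists_pos_sum_of_countable hδ' ℕ
  -- The radius is strictly larger than the diameter, so that an open ball about any point of the
  -- set contains it, even when the set is a single point; the summable `η i` absorbs the loss.
  have hR : ∀ i, ∃ R : ℝ, (Metric.ediam (t i)).toReal < R ∧
      ENNReal.ofReal (R ^ n) ≤ Metric.ediam (t i) ^ (n : ℝ) + η i := by
    intro i
    have hfin : Metric.ediam (t i) ≠ ⊤ := ne_top_of_le_ne_top ENNReal.one_ne_top (htd i)
    have hval : ENNReal.ofReal ((Metric.ediam (t i)).toReal ^ n) = Metric.ediam (t i) ^ (n : ℝ) := by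
      rw [ENNReal.ofReal_pow ENNReal.toReal_nonneg, ENNReal.ofReal_toReal hfin,
        ENNReal.rpow_natCast]
    have hcont : Tendsto (fun R : ℝ => ENNReal.ofReal (R ^ n))
        (𝓝[>] (Metric.ediam (t i)).toReal) (𝓝 (Metric.ediam (t i) ^ (n : ℝ))) := by
      rw [← hval]
      exact ((ENNReal.continuous_ofReal.comp (continuous_pow n)).tendsto _).mono_left
        nhdsWithin_le_nhds
    have hlt : Metric.ediam (t i) ^ (n : ℝ) < Metric.ediam (t i) ^ (n : ℝ) + η i := by
      refine ENNReal.lt_add_right ?_ (by exact_mod_cast (hη i).ne')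
      rw [← hval]
      exact ENNReal.ofReal_ne_top
    obtain ⟨R, hR1, hR2⟩ := ((hcont.eventually_lt_const hlt).and self_mem_nhdsWithin).exists
    exact ⟨R, hR2, hR1.le⟩
  choose R hdR hRη using hR
  -- Empty members must be dropped: they have no centre, and for n = 0 each of their balls would
  -- still cost R ^ 0 = 1.
  refine ⟨⋃ i, ⋃ h : (t i).Nonempty, Metric.ball h.some (R i), isOpen_iUnion fun i =>
    isOpen_iUnion fun _ => Metric.isOpen_ball, fun x hx => ?_, fun ν hν => ?_⟩
  · obtain ⟨i, hi⟩ := mem_iUnion.1 (hSt hx)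
    refine mem_iUnion.2 ⟨i, mem_iUnion.2 ⟨⟨x, hi⟩, ?_⟩⟩
    have hfin : Metric.ediam (t i) ≠ ⊤ := ne_top_of_le_ne_top ENNReal.one_ne_top (htd i)
    refine lt_of_le_of_lt ?_ (hdR i)
    rw [dist_edist]
    exact ENNReal.toReal_mono hfin
      (Metric.edist_le_ediam_of_mem hi (Set.Nonempty.some_mem ⟨x, hi⟩))
  · calc ν (⋃ i, ⋃ h : (t i).Nonempty, Metric.ball h.some (R i))
        ≤ ∑' i, ν (⋃ h : (t i).Nonempty, Metric.ball h.some (R i)) := measure_iUnion_le _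
      _ ≤ ∑' i, C * ((⨆ _ : (t i).Nonempty, Metric.ediam (t i) ^ (n : ℝ)) + η i) := by
          refine ENNReal.tsum_le_tsum fun i => ?_
          by_cases h : (t i).Nonempty
          · simp only [h, iUnion_true, iSup_pos]
            exact (hν _ (ENNReal.toReal_nonneg.trans_lt (hdR i)) _).trans (by gcongr; exact hRη i)
          · simp [h]
      _ = C * ((∑' i, ⨆ _ : (t i).Nonempty, Metric.ediam (t i) ^ (n : ℝ)) + ∑' i, (η i : ℝ≥0∞)) := by
          rw [ENNReal.tsum_mul_left, ENNReal.tsum_add]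
      _ ≤ C * (δ + δ) := by gcongr
      _ = δ * (C * 2) := by ring
      _ ≤ ε := hδε.le

/-! ### Localisation in space -/

/-- Weak continuity at a time, of a family of measures, is a local property in space. -/
theorem continuousAt_integral_of_locally {X : Type*} [TopologicalSpace X] [T2Space X]
    [LocallyCompactSpace X] [MeasurableSpace X] [OpensMeasurableSpace X]
    {μ : ℝ → Measure X} {t₀ : ℝ} (hμ : ∀ᶠ s in 𝓝 t₀, IsLocallyFiniteMeasure (μ s))
    {ψ : X → ℝ} (hψ : Continuous ψ) (hψc : HasCompactSupport ψ) (hψ0 : 0 ≤ ψ)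
    (h : ∀ x ∈ tsupport ψ, ∃ U : Set X, IsOpen U ∧ x ∈ U ∧ ∀ f : X → ℝ, Continuous f →
      HasCompactSupport f → 0 ≤ f → tsupport f ⊆ U → ContinuousAt (fun s => ∫ x, f x ∂(μ s)) t₀) :
    ContinuousAt (fun s => ∫ x, ψ x ∂(μ s)) t₀ := by
  choose! U hUo hxU hU using h
  obtain ⟨b, hb, hcov⟩ := hψc.isCompact.elim_nhds_subcover U fun x hx =>
    (hUo x hx).mem_nhds (hxU x hx)
  let e := b.equivFin.symm
  obtain ⟨f, hfs, hf1, hf01, hfc⟩ := exists_continuous_sum_one_of_isOpen_isCompact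
    (s := fun i => U (e i)) (fun i => hUo _ (hb _ (e i).2)) hψc.isCompact (by
      intro x hx
      obtain ⟨y, hy, hxy⟩ := mem_iUnion₂.1 (hcov hx)
      exact mem_iUnion.2 ⟨e.symm ⟨y, hy⟩, by simpa using hxy⟩)
  have hsum : ∀ x, ψ x = ∑ i, f i x * ψ x := by
    intro x
    by_cases hx : x ∈ tsupport ψ
    · have := hf1 hx
      simp only [Finset.sum_apply, Pi.one_apply] at this
      rw [← Finset.sum_mul, this, one_mul]
    · simp [image_eq_zero_of_notMem_tsupport hx]
  have hcont : ∀ i, ContinuousAt (fun s => ∫ x, f i x * ψ x ∂(μ s)) t₀ := fun i =>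
    hU _ (hb _ (e i).2) _ ((f i).continuous.mul hψ) hψc.mul_left
      (fun x => mul_nonneg (hf01 i x).1 (hψ0 x)) ((tsupport_mul_subset_left).trans (hfs i))
  have hall : ContinuousAt (fun s => ∑ i, ∫ x, f i x * ψ x ∂(μ s)) t₀ :=
    tendsto_finsetSum _ fun i _ => hcont i
  refine hall.congr ?_
  filter_upwards [hμ] with s hs
  rw [← integral_finsetSum]
  · exact integral_congr_ae (.of_forall fun x => (hsum x).symm)
  · exact fun i _ => ((f i).continuous.mul hψ).integrable_of_hasCompactSupport hψc.mul_left

/-! ### Area of moving patches -/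

/-- Replacing `h i` by `h₀` costs at most the uniform distance times the mass. As `h₀` is
nonnegative, the order bounds between the measures pass to its integrals, which are squeezed as c
tends to 1. -/
theorem tendsto_integral_of_le_smul {α ι : Type*} [MeasurableSpace α] {l : Filter ι}
    {ν : ι → Measure α} {ν₀ : Measure α} [IsFiniteMeasure ν₀]
    (hν : ∀ c : ℝ≥0, 1 < c → ∀ᶠ i in l, ν i ≤ c • ν₀ ∧ ν₀ ≤ c • ν i)
    {h : ι → α → ℝ} {h₀ : α → ℝ} (hm : ∀ᶠ i in l, Measurable (h i)) (hm₀ : Measurable h₀)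
    (hh₀ : 0 ≤ h₀) {B : ℝ} (hB : ∀ x, h₀ x ≤ B)
    (hh : ∀ δ > 0, ∀ᶠ i in l, ∀ x, |h i x - h₀ x| ≤ δ) :
    Tendsto (fun i => ∫ x, h i x ∂(ν i)) l (𝓝 (∫ x, h₀ x ∂ν₀)) := by
  have hint : ∀ (m : Measure α) [IsFiniteMeasure m], Integrable h₀ m := fun m _ =>
    Integrable.of_bound hm₀.aestronglyMeasurable B (.of_forall fun x => by
      rw [Real.norm_eq_abs, abs_of_nonneg (hh₀ x)]; exact hB x)
  set I := ∫ x, h₀ x ∂ν₀ with hI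
  have hI0 : 0 ≤ I := integral_nonneg hh₀
  set m := ν₀.real univ with hmdef
  have hm0 : 0 ≤ m := measureReal_nonneg
  rw [Metric.tendsto_nhds]
  intro ε hε
  -- With c = 1 + κ ≤ 2 the mass of `ν i` is at most 2m, so changing the integrand costs at most 2mδ
  -- < ε/2. Changing the measure costs at most κ(1 + κ)I ≤ 2κI < ε/2.
  set δ := ε / (4 * (m + 1)) with hδ
  have hδ0 : 0 < δ := by positivity
  have hδm : δ * (2 * m) < ε / 2 := by
    have : δ * (4 * (m + 1)) = ε := by rw [hδ]; field_simp
    nlinarith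
  set κ := min 1 (ε / (4 * (I + 1))) with hκ
  have hκ0 : 0 < κ := by positivity
  have hκ1 : κ ≤ 1 := min_le_left _ _
  have hκI : κ * (2 * I) < ε / 2 := by
    have h1 : κ ≤ ε / (4 * (I + 1)) := min_le_right _ _
    have h2 : ε / (4 * (I + 1)) * (4 * (I + 1)) = ε := by field_simp
    nlinarith
  let c : ℝ≥0 := ⟨1 + κ, by positivity⟩
  have hc : (c : ℝ) = 1 + κ := rfl
  filter_upwards [hν c (by rw [← NNReal.coe_lt_coe, hc]; simpa using hκ0), hm, hh δ hδ0] with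
    i ⟨hle, hge⟩ hmi hδi
  have : IsFiniteMeasure (ν i) := isFiniteMeasure_of_le _ hle
  have hJ1 : ∫ x, h₀ x ∂(ν i) ≤ (1 + κ) * I := by
    have := integral_mono_measure hle (.of_forall hh₀) (hint (c • ν₀))
    rwa [integral_smul_nnreal_measure] at this
  have hJ2 : I ≤ (1 + κ) * ∫ x, h₀ x ∂(ν i) := by
    have := integral_mono_measure hge (.of_forall hh₀) (hint (c • ν i))
    rwa [integral_smul_nnreal_measure] at this
  have hmass : (ν i).real univ ≤ 2 * m := by
    have h1 : (ν i).real univ ≤ (c • ν₀).real univ := by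
      exact ENNReal.toReal_mono (measure_ne_top _ _) (hle univ)
    have h2 : (c • ν₀).real univ = (1 + κ) * m := by
      rw [measureReal_nnreal_smul_apply, hc]
    nlinarith
  have hinti : Integrable (fun x => h i x - h₀ x) (ν i) :=
    Integrable.of_bound (hmi.sub hm₀).aestronglyMeasurable δ (.of_forall hδi)
  have hdiff : |∫ x, h i x ∂(ν i) - ∫ x, h₀ x ∂(ν i)| ≤ δ * (2 * m) := by
    have hi : Integrable (h i) (ν i) := by
      have := hinti.add (hint (ν i))
      rwa [show (fun x => h i x - h₀ x) + h₀ = h i from sub_add_cancel (h i) h₀] at this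
    rw [← integral_sub hi (hint _)]
    calc |∫ x, (h i x - h₀ x) ∂(ν i)| ≤ δ * (ν i).real univ := by
          rw [← Real.norm_eq_abs]
          exact norm_integral_le_of_norm_le_const (.of_forall hδi)
      _ ≤ δ * (2 * m) := by gcongr
  rw [Real.dist_eq]
  rw [abs_le] at hdiff
  rw [abs_lt]
  constructor <;> nlinarith

/-- If `f` is `K`-Lipschitz relative to `g` on `s`, then `ℋⁿ(f(s)) ≤ Kⁿ ℋⁿ(g(s))`. -/
theorem euclideanHausdorffMeasure_image_le {α X Y : Type*} [EMetricSpace X]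
    [MeasurableSpace X] [BorelSpace X] [EMetricSpace Y] [MeasurableSpace Y] [BorelSpace Y]
    {f : α → X} {g : α → Y} {s : Set α} {K : ℝ≥0} (n : ℕ)
    (h : ∀ p ∈ s, ∀ q ∈ s, edist (f p) (f q) ≤ K * edist (g p) (g q)) :
    μHE[n] (f '' s) ≤ (K ^ n : ℝ≥0) * μHE[n] (g '' s) := by
  rcases s.eq_empty_or_nonempty with rfl | ⟨p₀, hp₀⟩
  · simp
  have : Nonempty α := ⟨p₀⟩
  let u := Function.invFunOn g s
  have hu : ∀ p ∈ s, u (g p) ∈ s ∧ g (u (g p)) = g p := fun p hp =>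
    ⟨Function.invFunOn_mem ⟨p, hp, rfl⟩, Function.invFunOn_eq ⟨p, hp, rfl⟩⟩
  -- Although `g` need not be injective, the hypothesis at distance zero shows that `f` factors
  -- through `g` on `s`; the factor is K-Lipschitz on `g '' s`.
  have himg : f '' s = (f ∘ u) '' (g '' s) := by
    rw [image_image]
    refine image_congr fun p hp => ?_
    have := h p hp _ (hu p hp).1
    rw [(hu p hp).2, edist_self, mul_zero, nonpos_iff_eq_zero, edist_eq_zero] at this
    exact this
  have hlip : LipschitzOnWith K (f ∘ u) (g '' s) := by
    rintro _ ⟨p, hp, rfl⟩ _ ⟨q, hq, rfl⟩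
    have := h _ (hu p hp).1 _ (hu q hq).1
    rwa [(hu p hp).2, (hu q hq).2] at this
  have := hlip.hausdorffMeasure_image_le (d := (n : ℝ)) (Nat.cast_nonneg n)
  rw [himg, Measure.euclideanHausdorffMeasure_def, Measure.euclideanHausdorffMeasure_def,
    Measure.smul_apply, Measure.smul_apply, ENNReal.smul_def, ENNReal.smul_def, smul_eq_mul,
    smul_eq_mul, mul_left_comm]
  gcongr
  simpa using this

/-- A tube lemma: compactness makes continuity in time uniform over K, and keeps K × {s} inside the
open domain. -/
theorem eventually_forall_mem_dist_lt {P Y : Type*} [TopologicalSpace P] [PseudoMetricSpace Y]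
    {Ω : Set (P × ℝ)} (hΩ : IsOpen Ω) {K : Set P} (hK : IsCompact K) {t₀ : ℝ}
    (hKΩ : ∀ p ∈ K, (p, t₀) ∈ Ω) {g : P × ℝ → Y} (hg : ContinuousOn g Ω) {ε : ℝ} (hε : 0 < ε) :
    ∀ᶠ s in 𝓝 t₀, ∀ p ∈ K, (p, s) ∈ Ω ∧ dist (g (p, s)) (g (p, t₀)) < ε := by
  refine hK.eventually_forall_of_forall_eventually
    (P := fun s p => (p, s) ∈ Ω ∧ dist (g (p, s)) (g (p, t₀)) < ε) fun p hp => ?_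
  have hc : ContinuousAt g (p, t₀) := hg.continuousAt (hΩ.mem_nhds (hKΩ p hp))
  have hsw : Tendsto (fun z : ℝ × P => (z.2, z.1)) (𝓝 (t₀, p)) (𝓝 (p, t₀)) :=
    continuous_swap.tendsto (t₀, p)
  have hfst : Tendsto (fun z : ℝ × P => (z.2, t₀)) (𝓝 (t₀, p)) (𝓝 (p, t₀)) :=
    (show Continuous fun z : ℝ × P => (z.2, t₀) by fun_prop).tendsto (t₀, p)
  refine (hsw.eventually (hΩ.mem_nhds (hKΩ p hp))).and ?_
  have h1 := (hc.tendsto.comp hsw).dist (hc.tendsto.comp hfst)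
  rw [dist_self] at h1
  exact h1.eventually_lt_const hε

/-- A smooth family of maps, immersive at `p₀` at time `t₀`, is nearly isometric in time: near `p₀`
the distances between image points at times close to `t₀` are comparable to those at time `t₀`,
with constants arbitrarily close to `1`. -/
theorem exists_ball_eventually_edist_le {P Y : Type*} [NormedAddCommGroup P] [NormedSpace ℝ P]
    [FiniteDimensional ℝ P] [NormedAddCommGroup Y] [NormedSpace ℝ Y]
    {Ω : Set (P × ℝ)} (hΩ : IsOpen Ω) {F : P × ℝ → Y} (hF : ContDiffOn ℝ 1 F Ω) {p₀ : P} {t₀ : ℝ}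
    (hq : (p₀, t₀) ∈ Ω) (himm : Function.Injective (fderiv ℝ (fun p => F (p, t₀)) p₀)) :
    ∃ ρ > 0, (∀ p ∈ Metric.closedBall p₀ ρ, (p, t₀) ∈ Ω) ∧
      (∃ L : ℝ≥0, LipschitzOnWith L (fun p => F (p, t₀)) (Metric.ball p₀ ρ)) ∧
      ∀ c : ℝ≥0, 1 < c → ∀ᶠ s in 𝓝 t₀, ∀ p ∈ Metric.ball p₀ ρ, ∀ q ∈ Metric.ball p₀ ρ,
        edist (F (p, s)) (F (q, s)) ≤ c * edist (F (p, t₀)) (F (q, t₀)) ∧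
        edist (F (p, t₀)) (F (q, t₀)) ≤ c * edist (F (p, s)) (F (q, s)) := by
  have hcd : ContDiffAt ℝ 1 (fun p => F (p, t₀)) p₀ :=
    (hF.contDiffAt (hΩ.mem_nhds hq)).comp p₀ (contDiffAt_id.prodMk contDiffAt_const)
  have hstrict := hcd.hasStrictFDerivAt one_ne_zero
  set A := fderiv ℝ (fun p => F (p, t₀)) p₀ with hA
  obtain ⟨K, hK, hAK⟩ := (A : P →ₗ[ℝ] Y).injective_iff_antilipschitz.1 himm
  have hK' : (0 : ℝ) < K := hK
  obtain ⟨L, S, hS, hL⟩ := hstrict.exists_lipschitzOnWith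
  -- A expands distances by at least 1/K. An error of half that rate leaves the lower bound 1/(2K)
  -- for F(·, t₀) near p₀.
  have happrox := hstrict.isLittleO.def (c := 1 / (2 * K)) (by positivity)
  rw [nhds_prod_eq] at happrox
  obtain ⟨S', hS', happ⟩ := (eventually_prod_self_iff (r := fun p q =>
    ‖F (p, t₀) - F (q, t₀) - A (p - q)‖ ≤ 1 / (2 * K) * ‖p - q‖)).1 happrox
  have hslice : ∀ᶠ p in 𝓝 p₀, (p, t₀) ∈ Ω :=
    (show Continuous fun p : P => (p, t₀) by fun_prop).tendsto p₀ (hΩ.mem_nhds hq)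
  obtain ⟨ρ, hρ, hball⟩ := Metric.nhds_basis_closedBall.mem_iff.1
    (inter_mem (inter_mem hS hS') hslice)
  refine ⟨ρ, hρ, fun p hp => (hball hp).2, ⟨L, hL.mono fun p hp =>
    (hball (Metric.ball_subset_closedBall hp)).1.1⟩, fun c hc => ?_⟩
  have hlow : ∀ p ∈ Metric.ball p₀ ρ, ∀ q ∈ Metric.ball p₀ ρ,
      ‖p - q‖ ≤ 2 * K * ‖F (p, t₀) - F (q, t₀)‖ := by
    intro p hp q hq
    have h1 := happ p (hball (Metric.ball_subset_closedBall hp)).1.2 q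
      (hball (Metric.ball_subset_closedBall hq)).1.2
    have h2 := hAK.le_mul_dist p q
    rw [dist_eq_norm, dist_eq_norm] at h2
    have h3 : ‖A p - A q‖ ≤ ‖F (p, t₀) - F (q, t₀)‖ +
        ‖F (p, t₀) - F (q, t₀) - A (p - q)‖ := by
      rw [← map_sub]
      exact norm_le_norm_add_norm_sub _ _
    have h4 : ‖p - q‖ ≤ K * (‖F (p, t₀) - F (q, t₀)‖ + 1 / (2 * K) * ‖p - q‖) :=
      h2.trans (by gcongr; exact h3.trans (by gcongr))
    have h5 : (K : ℝ) * (1 / (2 * K) * ‖p - q‖) = ‖p - q‖ / 2 := by field_simp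
    rw [mul_add, h5] at h4
    linarith
  have hc' : (1 : ℝ) < c := by exact_mod_cast hc
  -- A relative error η = 1 - 1/c serves both directions: 1 + η ≤ c and 1/(1 - η) = c.
  set η : ℝ := (c - 1) / c with hη
  have hη0 : 0 < η := div_pos (by linarith) (by linarith)
  have hηc : c * η = c - 1 := by rw [hη]; field_simp
  have hD : ∀ p s, (p, s) ∈ Ω → HasFDerivAt (fun p => F (p, s))
      ((fderiv ℝ F (p, s)).comp (ContinuousLinearMap.inl ℝ P ℝ)) p := fun p s hps =>
    (((hF.differentiableOn one_ne_zero).differentiableAt (hΩ.mem_nhds hps)).hasFDerivAt).comp p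
      (hasFDerivAt_prodMk_left p s)
  have hDc : ContinuousOn (fun q => (fderiv ℝ F q).comp (ContinuousLinearMap.inl ℝ P ℝ)) Ω :=
    (hF.continuousOn_fderiv_of_isOpen hΩ le_rfl).clm_comp continuousOn_const
  filter_upwards [eventually_forall_mem_dist_lt hΩ (isCompact_closedBall p₀ ρ)
    (fun p hp => (hball hp).2) hDc (ε := η / (2 * K)) (by positivity)] with s hs
  intro p hp q hq
  -- Uniform closeness of the maps would not compare distances at small scales. The mean value
  -- inequality for F(·, s) - F(·, t₀), whose derivative is uniformly small, gives an error
  -- proportional to ‖p - q‖.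
  have hdiff : ‖(F (p, s) - F (p, t₀)) - (F (q, s) - F (q, t₀))‖ ≤ η / (2 * K) * ‖p - q‖ := by
    refine (convex_closedBall p₀ ρ).norm_image_sub_le_of_norm_hasFDerivWithin_le
      (f := fun p => F (p, s) - F (p, t₀)) (fun x hx =>
        ((hD x s (hs x hx).1).sub (hD x t₀ (hball hx).2)).hasFDerivWithinAt) (fun x hx => ?_)
      (Metric.ball_subset_closedBall hq) (Metric.ball_subset_closedBall hp)
    rw [← dist_eq_norm]
    exact (hs x hx).2.le
  have hdiff' : ‖(F (p, s) - F (q, s)) - (F (p, t₀) - F (q, t₀))‖ ≤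
      η * ‖F (p, t₀) - F (q, t₀)‖ := by
    rw [sub_sub_sub_comm]
    refine hdiff.trans ?_
    calc η / (2 * K) * ‖p - q‖ ≤ η / (2 * K) * (2 * K * ‖F (p, t₀) - F (q, t₀)‖) := by
          gcongr; exact hlow p hp q hq
      _ = η * ‖F (p, t₀) - F (q, t₀)‖ := by field_simp
  have hup := norm_le_norm_add_norm_sub' (F (p, s) - F (q, s)) (F (p, t₀) - F (q, t₀))
  have hdn := norm_le_norm_add_norm_sub (F (p, s) - F (q, s)) (F (p, t₀) - F (q, t₀))
  have key : ∀ a b a' b' : Y, ‖a - b‖ ≤ c * ‖a' - b'‖ → edist a b ≤ c * edist a' b' := by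
    intro a b a' b' h
    rw [edist_nndist, edist_nndist]
    norm_cast
    rw [← NNReal.coe_le_coe, NNReal.coe_mul, coe_nndist, coe_nndist, dist_eq_norm, dist_eq_norm]
    exact h
  have hn := norm_nonneg (F (p, t₀) - F (q, t₀))
  constructor <;> refine key _ _ _ _ ?_
  · have h1 : η ≤ c - 1 := by nlinarith
    nlinarith
  · have h1 : c * ‖F (p, t₀) - F (q, t₀)‖ ≤
        c * (‖F (p, s) - F (q, s)‖ + η * ‖F (p, t₀) - F (q, t₀)‖) := by
      gcongr
      exact hdn.trans (by gcongr)
    rw [mul_add, ← mul_assoc, hηc] at h1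
    linarith

/-- The area measures of a smoothly moving immersed patch converge weakly. -/
theorem tendsto_setIntegral_image_ball {n N : ℕ} {Ω : Set (E n × ℝ)} (hΩ : IsOpen Ω)
    {F : E n × ℝ → E N} (hF : ContinuousOn F Ω) {p₀ : E n} {t₀ ρ : ℝ}
    (hinj : ∀ s, InjOn (fun p => F (p, s)) {p | (p, s) ∈ Ω})
    (hball : ∀ p ∈ Metric.closedBall p₀ ρ, (p, t₀) ∈ Ω) {L : ℝ≥0}
    (hL : LipschitzOnWith L (fun p => F (p, t₀)) (Metric.ball p₀ ρ))
    (hc : ∀ c : ℝ≥0, 1 < c → ∀ᶠ s in 𝓝 t₀, ∀ p ∈ Metric.ball p₀ ρ, ∀ q ∈ Metric.ball p₀ ρ,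
        edist (F (p, s)) (F (q, s)) ≤ c * edist (F (p, t₀)) (F (q, t₀)) ∧
        edist (F (p, t₀)) (F (q, t₀)) ≤ c * edist (F (p, s)) (F (q, s)))
    {f : E N → ℝ} (hf : Continuous f) (hfc : HasCompactSupport f) (hf0 : 0 ≤ f) :
    Tendsto (fun s => ∫ y in (fun p => F (p, s)) '' Metric.ball p₀ ρ, f y ∂μHE[n]) (𝓝 t₀)
      (𝓝 (∫ y in (fun p => F (p, t₀)) '' Metric.ball p₀ ρ, f y ∂μHE[n])) := by
  -- All area measures are pulled back to the fixed parameter ball, where they can be compared.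
  -- Continuous injections from this standard Borel space are measurable embeddings (Lusin–Souslin).
  let e : ℝ → Metric.ball p₀ ρ → E N := fun s p => F (p, s)
  have hStd : StandardBorelSpace (Metric.ball p₀ ρ) := Metric.isOpen_ball.measurableSet.standardBorel
  have hmem : ∀ᶠ s in 𝓝 t₀, ∀ p ∈ Metric.closedBall p₀ ρ, (p, s) ∈ Ω :=
    (eventually_forall_mem_dist_lt hΩ (isCompact_closedBall p₀ ρ) hball hF one_pos).mono
      fun s hs p hp => (hs p hp).1
  have hemb : ∀ s, (∀ p ∈ Metric.closedBall p₀ ρ, (p, s) ∈ Ω) → MeasurableEmbedding (e s) := by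
    intro s hs
    have hcont : Continuous (e s) := by
      refine hF.comp_continuous (by fun_prop) fun p => hs p (Metric.ball_subset_closedBall p.2)
    refine hcont.measurable.measurableEmbedding fun p q hpq => Subtype.ext ?_
    exact hinj s (hs p (Metric.ball_subset_closedBall p.2))
      (hs q (Metric.ball_subset_closedBall q.2)) hpq
  have hrange : ∀ s (A : Set (Metric.ball p₀ ρ)), e s '' A = (fun p => F (p, s)) '' (Subtype.val '' A) :=
    fun s A => by rw [image_image]
  have hint : ∀ s, (∀ p ∈ Metric.closedBall p₀ ρ, (p, s) ∈ Ω) →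
      ∫ y in (fun p => F (p, s)) '' Metric.ball p₀ ρ, f y ∂μHE[n] =
        ∫ p, f (e s p) ∂((μHE[n] : Measure (E N)).comap (e s)) := by
    intro s hs
    rw [← (hemb s hs).integral_map, (hemb s hs).map_comap, ← image_univ, hrange, image_univ,
      Subtype.range_coe]
  have hfin : IsFiniteMeasure ((μHE[n] : Measure (E N)).comap (e t₀)) := by
    refine ⟨?_⟩
    rw [(hemb t₀ hball).comap_apply]
    have hle := euclideanHausdorffMeasure_image_le (f := e t₀)
      (g := (Subtype.val : Metric.ball p₀ ρ → E n)) (s := univ) (K := L) n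
      fun p _ q _ => hL p.2 q.2
    refine hle.trans_lt (ENNReal.mul_lt_top ENNReal.coe_lt_top ?_)
    have hHaar : (μHE[n] : Measure (E n)).IsAddHaarMeasure := by
      have := isAddHaarMeasure_euclideanHausdorffMeasure (E := E n)
      rwa [finrank_euclideanSpace_fin] at this
    rw [image_univ, Subtype.range_coe]
    exact measure_ball_lt_top
  obtain ⟨B, hB⟩ := hfc.exists_bound_of_continuous hf
  rw [hint t₀ hball]
  refine Tendsto.congr' (hmem.mono fun s hs => (hint s hs).symm) ?_
  refine tendsto_integral_of_le_smul (B := B) (fun c hc1 => ?_) (hmem.mono fun s hs =>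
    hf.measurable.comp (hemb s hs).measurable) (hf.measurable.comp (hemb t₀ hball).measurable)
    (fun p => hf0 _) (fun p => (le_abs_self _).trans (hB _)) fun δ hδ => ?_
  -- Area scales with the n-th power of the distance ratio, so the ratio K > 1 is chosen with Kⁿ <
  -- c.
  · have hpow : Tendsto (fun K : ℝ≥0 => K ^ n) (𝓝[>] 1) (𝓝 1) := by
      simpa using ((continuous_pow n).tendsto (1 : ℝ≥0)).mono_left nhdsWithin_le_nhds
    obtain ⟨K, hK, hK1⟩ := ((hpow.eventually_lt_const hc1).and self_mem_nhdsWithin).exists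
    filter_upwards [hc K hK1, hmem] with s hs hsΩ
    have hKc : ((K ^ n : ℝ≥0) : ℝ≥0∞) ≤ c := by exact_mod_cast hK.le
    constructor <;> refine Measure.le_iff.2 fun A _ => ?_ <;>
      rw [Measure.smul_apply, (hemb s hsΩ).comap_apply, (hemb t₀ hball).comap_apply,
        ENNReal.smul_def, smul_eq_mul]
    · have hle := euclideanHausdorffMeasure_image_le (f := e s) (g := e t₀) (s := A) (K := K) n
        fun p _ q _ => (hs p.1 p.2 q.1 q.2).1
      exact hle.trans (by gcongr)
    · have hle := euclideanHausdorffMeasure_image_le (f := e t₀) (g := e s) (s := A) (K := K) n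
        fun p _ q _ => (hs p.1 p.2 q.1 q.2).2
      exact hle.trans (by gcongr)
  · filter_upwards [eventually_forall_mem_dist_lt hΩ (isCompact_closedBall p₀ ρ) hball
      (hf.comp_continuousOn hF) hδ] with s hs p
    exact (hs p (Metric.ball_subset_closedBall p.2)).2.le

/-! ### Weak continuity at points off the singular slice -/

/-- A family of measures that near a point is the area measure of a smoothly moving submanifold is
weakly continuous near that point. -/
theorem IsFlowChart.exists_isOpen_continuousAt_integral {n N : ℕ} {M : ℝ → Set (E N)} {I : Set ℝ}
    {Ω : Set (E n × ℝ)} {F : E n × ℝ → E N} (h : IsFlowChart M I Ω F) {q₀ : E n × ℝ} (hq₀ : q₀ ∈ Ω)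
    {μ : ℝ → Measure (E N)} {U₀ : Set (E N)} (hU₀ : IsOpen U₀) (hq₀U : F q₀ ∈ U₀)
    (hI : ∀ᶠ s in 𝓝 q₀.2, s ∈ I)
    (hμ : ∀ᶠ s in 𝓝 q₀.2, (μ s).restrict U₀ = (μHE[n]).restrict (M s)) :
    ∃ U : Set (E N), IsOpen U ∧ F q₀ ∈ U ∧ ∀ f : E N → ℝ, Continuous f →
      HasCompactSupport f → 0 ≤ f → tsupport f ⊆ U →
        ContinuousAt (fun s => ∫ x, f x ∂(μ s)) q₀.2 := by
  obtain ⟨p₀, t₀⟩ := q₀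
  obtain ⟨ρ, hρ, hball, ⟨L, hL⟩, hc⟩ := exists_ball_eventually_edist_le h.isOpen
    (h.contDiffOn.of_le (by exact_mod_cast le_top)) hq₀ (h.immersion _ hq₀)
  have hinj : ∀ s, InjOn (fun p => F (p, s)) {p | (p, s) ∈ Ω} := by
    intro s p hp q hq hpq
    have := h.isEmbedding.injective (a₁ := ⟨(p, s), hp⟩) (a₂ := ⟨(q, s), hq⟩)
      (Prod.ext hpq rfl)
    exact (Prod.ext_iff.1 (Subtype.ext_iff.1 this)).1
  obtain ⟨Z, hZ, hZeq⟩ := h.image_eq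
  -- `Z` separates the chart from the rest of the track. `Z'`, supplied by the embedding property,
  -- excludes chart points with parameter outside the ball, which could otherwise return close to F
  -- q₀. Within both, each slice of the track is exactly the image of the ball.
  have hopen : IsOpen {q : Ω | (q : E n × ℝ).1 ∈ Metric.ball p₀ ρ} :=
    Metric.isOpen_ball.preimage (continuous_fst.comp continuous_subtype_val)
  obtain ⟨Z', hZ', hZ'eq⟩ := h.isEmbedding.isInducing.isOpen_iff.1 hopen
  have hq₀Z : (F (p₀, t₀), t₀) ∈ Z :=
    (hZeq.symm.subset (mem_image_of_mem (fun q => (F q, q.2)) hq₀)).2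
  have hq₀Z' : (F (p₀, t₀), t₀) ∈ Z' :=
    hZ'eq.symm.subset (show (⟨(p₀, t₀), hq₀⟩ : Ω) ∈ _ from Metric.mem_ball_self hρ)
  obtain ⟨U₁, hU₁, J, hJ, hUJ⟩ := mem_nhds_prod_iff.1
    (inter_mem (hZ.mem_nhds hq₀Z) (hZ'.mem_nhds hq₀Z'))
  have hUo : IsOpen (interior U₁ ∩ U₀) := isOpen_interior.inter hU₀
  refine ⟨interior U₁ ∩ U₀, hUo, ⟨mem_interior_iff_mem_nhds.2 hU₁, hq₀U⟩,
    fun f hf hfc hf0 hfU => ?_⟩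
  set U := interior U₁ ∩ U₀ with hUdef
  have hkey : ∀ᶠ s in 𝓝 t₀, ∫ y in (fun p => F (p, s)) '' Metric.ball p₀ ρ, f y ∂μHE[n] =
      ∫ x, f x ∂(μ s) := by
    filter_upwards [hI, hμ, hJ, eventually_forall_mem_dist_lt h.isOpen (isCompact_closedBall p₀ ρ)
      hball h.contDiffOn.continuousOn one_pos] with s hsI hsμ hsJ hsΩ
    have hset : U ∩ M s = U ∩ (fun p => F (p, s)) '' Metric.ball p₀ ρ := by
      ext y
      refine and_congr_right fun hyU => ⟨fun hy => ?_, ?_⟩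
      · have hyZ := hUJ (mk_mem_prod (interior_subset hyU.1) hsJ)
        obtain ⟨q, hq, hqy⟩ := hZeq.subset ⟨⟨hsI, hy⟩, hyZ.1⟩
        obtain ⟨hq1, hq2⟩ := Prod.ext_iff.1 hqy
        have hqb : (⟨q, hq⟩ : Ω) ∈ {q : Ω | (q : E n × ℝ).1 ∈ Metric.ball p₀ ρ} := by
          rw [← hZ'eq]
          change (F q, q.2) ∈ Z'
          exact (show (F q, q.2) = (y, s) from hqy) ▸ hyZ.2
        obtain rfl : q.2 = s := hq2
        exact ⟨q.1, hqb, hq1⟩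
      · rintro ⟨p, hp, rfl⟩
        exact (hZeq.symm.subset (mem_image_of_mem (fun q => (F q, q.2))
          (hsΩ p (Metric.ball_subset_closedBall hp)).1)).1.2
    have hres : ∀ m : Measure (E N), ∫ y in U, f y ∂m = ∫ y, f y ∂m := fun m =>
      setIntegral_eq_integral_of_forall_compl_eq_zero fun x hx =>
        image_eq_zero_of_notMem_tsupport fun hx' => hx (hfU hx')
    rw [← hres, Measure.restrict_restrict hUo.measurableSet, ← hset,
      ← Measure.restrict_restrict hUo.measurableSet, ← hsμ,
      Measure.restrict_restrict hUo.measurableSet,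
      inter_eq_left.2 (inter_subset_right : U ⊆ U₀), hres]
  have hlim := tendsto_setIntegral_image_ball h.isOpen h.contDiffOn.continuousOn hinj hball hL hc
    hf hfc hf0
  rw [hkey.self_of_nhds] at hlim
  exact hlim.congr' hkey

/-- A Brakke flow is weakly continuous near a fully smooth point. -/
theorem IsFullySmooth.exists_isOpen_continuousAt_integral {n N : ℕ} {μ : ℝ → Measure (E N)}
    {x₀ : E N} {t₀ : ℝ} (h : IsFullySmooth n μ (x₀, t₀)) :
    ∃ U : Set (E N), IsOpen U ∧ x₀ ∈ U ∧ ∀ f : E N → ℝ, Continuous f →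
      HasCompactSupport f → 0 ≤ f → tsupport f ⊆ U →
        ContinuousAt (fun s => ∫ x, f x ∂(μ s)) t₀ := by
  obtain ⟨r, ε, hr, hε, -, M, hM, hμ⟩ := h
  set I := Ioo (t₀ - ε ^ 2) (t₀ + ε ^ 2) with hIdef
  have hε2 : 0 < ε ^ 2 := by positivity
  have hI : I ∈ 𝓝 t₀ := Ioo_mem_nhds (by linarith) (by linarith)
  -- The centre of the ball need not lie on the submanifold. If it does not, properness keeps the
  -- track away from a spacetime neighbourhood, where all nearby integrals vanish.
  by_cases hx : (x₀, t₀) ∈ track M I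
  · obtain ⟨Ω, F, hF, q, hq, hqx⟩ := hM.exists_chart _ hx
    obtain ⟨hq1, rfl⟩ := Prod.ext_iff.1 hqx
    simp only at hq1
    rw [← hq1]
    exact hF.exists_isOpen_continuousAt_integral hq Metric.isOpen_ball
      (hq1 ▸ Metric.mem_ball_self hr) hI (mem_of_superset hI hμ)
  · have hcl : (x₀, t₀) ∉ closure (track M I) := fun hmem =>
      hx (hM.proper ⟨hmem, Metric.mem_ball_self hr, mem_of_mem_nhds hI⟩)
    obtain ⟨U₁, hU₁, J, hJ, hUJ⟩ := mem_nhds_prod_iff.1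
      (isClosed_closure.isOpen_compl.mem_nhds hcl)
    refine ⟨interior U₁ ∩ Metric.ball x₀ r, isOpen_interior.inter Metric.isOpen_ball,
      ⟨mem_interior_iff_mem_nhds.2 hU₁, Metric.mem_ball_self hr⟩, fun f _ _ _ hfU => ?_⟩
    have hzero : ∀ᶠ s in 𝓝 t₀, (0 : ℝ) = ∫ x, f x ∂(μ s) := by
      filter_upwards [hI, hJ] with s hsI hsJ
      have hres : ∫ y in interior U₁ ∩ Metric.ball x₀ r, f y ∂(μ s) = ∫ y, f y ∂(μ s) :=
        setIntegral_eq_integral_of_forall_compl_eq_zero fun x hx =>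
          image_eq_zero_of_notMem_tsupport fun hx' => hx (hfU hx')
      have hempty : interior U₁ ∩ M s = ∅ := by
        refine eq_empty_of_forall_notMem fun y hy => ?_
        exact hUJ (mk_mem_prod (interior_subset hy.1) hsJ) (subset_closure ⟨hsI, hy.2⟩)
      rw [← hres, ← Measure.restrict_restrict isOpen_interior.measurableSet, hμ s hsI,
        Measure.restrict_restrict isOpen_interior.measurableSet, hempty, Measure.restrict_empty,
        integral_zero_measure]
    have hlim : Tendsto (fun _ : ℝ => (0 : ℝ)) (𝓝 t₀) (𝓝 (∫ x, f x ∂(μ t₀))) := by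
      rw [← hzero.self_of_nhds]
      exact tendsto_const_nhds
    exact hlim.congr' hzero

/-- The complement of the closed spacetime support contains a product neighbourhood, in which μ_s
has no mass. Positivity of t₀ makes all nearby times nonnegative, the only ones the spacetime
support records. -/
theorem exists_isOpen_continuousAt_integral_of_notMem_spacetimeSupport {N : ℕ}
    {μ : ℝ → Measure (E N)} {x₀ : E N} {t₀ : ℝ} (ht₀ : 0 < t₀)
    (h : (x₀, t₀) ∉ spacetimeSupport μ) :
    ∃ U : Set (E N), IsOpen U ∧ x₀ ∈ U ∧ ∀ f : E N → ℝ, Continuous f →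
      HasCompactSupport f → 0 ≤ f → tsupport f ⊆ U →
        ContinuousAt (fun s => ∫ x, f x ∂(μ s)) t₀ := by
  obtain ⟨U₁, hU₁, J, hJ, hUJ⟩ := mem_nhds_prod_iff.1 (isClosed_closure.isOpen_compl.mem_nhds h)
  refine ⟨interior U₁, isOpen_interior, mem_interior_iff_mem_nhds.2 hU₁, fun f _ _ _ hfU => ?_⟩
  have hzero : ∀ᶠ s in 𝓝 t₀, (0 : ℝ) = ∫ x, f x ∂(μ s) := by
    filter_upwards [hJ, Ioi_mem_nhds ht₀] with s hsJ hs
    have hnull : μ s (interior U₁) = 0 := by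
      refine measure_mono_null (fun y hy => ?_) (Measure.measure_compl_support (μ := μ s))
      exact fun hys => hUJ (mk_mem_prod (interior_subset hy) hsJ)
        (subset_closure ⟨le_of_lt hs, hys⟩)
    rw [← setIntegral_eq_integral_of_forall_compl_eq_zero (s := interior U₁) fun x hx =>
      image_eq_zero_of_notMem_tsupport fun hx' => hx (hfU hx'),
      Measure.restrict_eq_zero.2 hnull, integral_zero_measure]
  have hlim : Tendsto (fun _ : ℝ => (0 : ℝ)) (𝓝 t₀) (𝓝 (∫ x, f x ∂(μ t₀))) := by
    rw [← hzero.self_of_nhds]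
    exact tendsto_const_nhds
  exact hlim.congr' hzero

/-! ### Gluing and conclusion -/

/-- Weak continuity off sets that carry uniformly little mass implies weak continuity. -/
theorem continuousAt_integral_of_locally_off_small {X : Type*} [TopologicalSpace X] [T2Space X]
    [LocallyCompactSpace X] [MeasurableSpace X] [BorelSpace X]
    {μ : ℝ → Measure X} {t₀ : ℝ} (hμ : ∀ᶠ s in 𝓝 t₀, IsLocallyFiniteMeasure (μ s)) {S : Set X}
    (hS : ∀ ε : ℝ≥0∞, ε ≠ 0 → ∃ V, IsOpen V ∧ S ⊆ V ∧ ∀ᶠ s in 𝓝 t₀, μ s V ≤ ε)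
    (h : ∀ x ∉ S, ∃ U : Set X, IsOpen U ∧ x ∈ U ∧ ∀ f : X → ℝ, Continuous f →
      HasCompactSupport f → 0 ≤ f → tsupport f ⊆ U → ContinuousAt (fun s => ∫ x, f x ∂(μ s)) t₀)
    {ψ : X → ℝ} (hψ : Continuous ψ) (hψc : HasCompactSupport ψ) (hψ0 : 0 ≤ ψ) :
    ContinuousAt (fun s => ∫ x, ψ x ∂(μ s)) t₀ := by
  obtain ⟨B, hB⟩ := hψc.exists_bound_of_continuous hψ
  rw [ContinuousAt, Metric.tendsto_nhds]
  intro ε hε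
  obtain ⟨δ, hδ0, hδ⟩ : ∃ δ : ℝ, 0 < δ ∧ |B| * δ ≤ ε / 4 :=
    ⟨ε / (4 * (|B| + 1)), by positivity, by
      have : ε / (4 * (|B| + 1)) * (|B| + 1) = ε / 4 := by field_simp
      nlinarith [abs_nonneg B, div_pos hε (by positivity : 0 < 4 * (|B| + 1))]⟩
  obtain ⟨V, hVo, hSV, hV⟩ := hS (ENNReal.ofReal δ) (by simpa using hδ0)
  choose! U hUo hxU hU using h
  set W : Set X := ⋃ x ∈ Sᶜ, U x with hW
  have hWo : IsOpen W := isOpen_biUnion fun x hx => hUo x hx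
  have hKW : tsupport ψ \ V ⊆ W := fun x hx =>
    mem_biUnion (show x ∈ Sᶜ from fun hxS => hx.2 (hSV hxS)) (hxU x fun hxS => hx.2 (hSV hxS))
  -- χψ is supported where local continuity holds, while (1 - χ)ψ vanishes off V and so contributes
  -- at most |B| μ_s(V) ≤ ε/4.
  obtain ⟨χ, hχ1, hχc, hχW, hχ01⟩ := exists_continuousMap_one_of_isCompact_subset_isOpen
    (hψc.isCompact.diff hVo) hWo hKW
  have hcont : ContinuousAt (fun s => ∫ x, χ x * ψ x ∂(μ s)) t₀ := by
    refine continuousAt_integral_of_locally hμ (χ.continuous.mul hψ) hψc.mul_left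
      (fun x => mul_nonneg (hχ01 x).1 (hψ0 x)) fun x hx => ?_
    obtain ⟨y, hy, hxy⟩ := mem_iUnion₂.1 (hχW (tsupport_mul_subset_left hx))
    exact ⟨U y, hUo y hy, hxy, hU y hy⟩
  have hrest : ∀ᶠ s in 𝓝 t₀, |∫ x, ψ x ∂(μ s) - ∫ x, χ x * ψ x ∂(μ s)| ≤ ε / 4 := by
    filter_upwards [hμ, hV] with s hs hsV
    have hint : Integrable (fun x => χ x * ψ x) (μ s) :=
      (χ.continuous.mul hψ).integrable_of_hasCompactSupport hψc.mul_left
    rw [← integral_sub (hψ.integrable_of_hasCompactSupport hψc) hint,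
      ← setIntegral_eq_integral_of_forall_compl_eq_zero (s := V) fun x hx => ?_]
    · have hVtop : μ s V < ⊤ := hsV.trans_lt ENNReal.ofReal_lt_top
      have hbd := norm_setIntegral_le_of_norm_le_const (f := fun x => ψ x - χ x * ψ x)
        (C := |B|) hVtop fun x _ => by
          have h1 := hB x
          have h2 := hχ01 x
          rw [Real.norm_eq_abs] at h1 ⊢
          have h3 : ψ x - χ x * ψ x = (1 - χ x) * ψ x := by ring
          rw [h3, abs_mul, abs_of_nonneg (by linarith [h2.2])]
          nlinarith [abs_nonneg (ψ x), le_abs_self B, h2.1]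
      rw [Real.norm_eq_abs] at hbd
      refine hbd.trans (le_trans ?_ hδ)
      gcongr
      exact ENNReal.toReal_le_of_le_ofReal hδ0.le hsV
    · by_cases hx' : x ∈ tsupport ψ
      · have := hχ1 ⟨hx', hx⟩
        simp only [Pi.one_apply] at this
        rw [this]; ring
      · simp [image_eq_zero_of_notMem_tsupport hx']
  filter_upwards [hrest, (Metric.tendsto_nhds.1 hcont) (ε / 4) (by positivity)] with s hs1 hs2
  -- The remainder bound is needed at s and at t₀ itself; with the continuity of the main piece this
  -- makes three errors of ε/4.
  have hs0 := hrest.self_of_nhds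
  rw [Real.dist_eq] at hs2 ⊢
  rw [abs_le] at hs0 hs1
  rw [abs_lt] at hs2 ⊢
  constructor <;> linarith

end BrakkeFlow

theorem mainTheorem3 (n k : ℕ) (hk : 0 < k) (T : ℝ) (hT : 0 < T)
    (μ : ℝ → MeasureTheory.Measure (BrakkeFlow.E (n + k)))
    (hflow : BrakkeFlow.IsIntegralBrakkeFlow n μ)
    (hratio : BrakkeFlow.HasBoundedAreaRatios n μ)
    (hsing : ∀ t ∈ Set.Ioo 0 T, μHE[n] (BrakkeFlow.singPlusSlice n μ t) = 0) :
    ∀ φ : BrakkeFlow.E (n + k) → ℝ, BrakkeFlow.IsTestFunction φ →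
      ContinuousOn (fun t => ∫ x, φ x ∂(μ t)) (Set.Ioo 0 T) := by
  intro φ hφ t₀ ht₀
  refine ContinuousAt.continuousWithinAt ?_
  have hpos : ∀ᶠ s in 𝓝 t₀, 0 ≤ s := (eventually_gt_nhds ht₀.1).mono fun s hs => le_of_lt hs
  obtain ⟨Λ, hΛ⟩ := hratio
  refine BrakkeFlow.continuousAt_integral_of_locally_off_small
    (S := BrakkeFlow.singPlusSlice n μ t₀) (hpos.mono hflow.radon) (fun ε hε => ?_)
    (fun x hx => ?_) hφ.contDiff.continuous hφ.hasCompactSupport hφ.nonneg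
  · obtain ⟨V, hVo, hSV, hV⟩ := BrakkeFlow.exists_isOpen_forall_measure_le (hsing t₀ ht₀)
      (C := Λ * volume (Metric.ball (0 : BrakkeFlow.E n) 1))
      (ENNReal.mul_ne_top ENNReal.coe_ne_top measure_ball_lt_top.ne) hε
    refine ⟨V, hVo, hSV, hpos.mono fun s hs => hV _ fun R hR x => ?_⟩
    rw [mul_assoc]
    exact hΛ s hs R hR x
  -- A point off the singular slice is outside the spacetime support or regular. As t₀ > 0, regular
  -- then means fully smooth, since the other part of the regular set lies at time 0.
  · by_cases hspt : (x, t₀) ∈ BrakkeFlow.spacetimeSupport μ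
    · have hreg : (x, t₀) ∈ BrakkeFlow.regPlus n μ := by
        by_contra hreg
        exact hx ⟨hspt, hreg⟩
      rcases hreg with hreg | hreg
      · exact absurd hreg.2 ht₀.1.ne'
      · exact hreg.2.exists_isOpen_continuousAt_integral
    · exact BrakkeFlow.exists_isOpen_continuousAt_integral_of_notMem_spacetimeSupport ht₀.1 hspt
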